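/- A \emph{permutation} is a finite (possibly empty) sequence $\pi=\pi_1\pi_2\cdots\pi_m$ of distinct positive integers; $|\pi|=m$ is its length and $\operatorname{dom}(\pi)=\{\pi_1,\dots,\pi_m\}$ its domain. Put $\operatorname{Des}(\pi)=\{i : 1\le i<m,\ \pi_i>\pi_{i+1}\}$, $\operatorname{des}(\pi)=\#\operatorname{Des}(\pi)$ and $\operatorname{maj}(\pi)=\sum_{i\in\operatorname{Des}(\pi)} i$. For permutations $\pi,\sigma$ with disjoint domains, the shuffle set $S(\pi,\sigma)$ is the set of all permutations with domain $\operatorname{dom}(\pi)\cup\operatorname{dom}(\sigma)$ that contain both $\pi$ and $\sigma$ as (not necessarily contiguous) subsequences. A \emph{permutation statistic} is a function $\operatorname{St}$ on permutations whose value depends only on the relative order of the entries. It is \emph{shuffle compatible} if, for all permutations $\pi,\pi',\sigma,\sigma'$ with $|\pi|=|\pi'|$, $|\sigma|=|\sigma'|$, $\operatorname{dom}(\pi)\cap\operatorname{dom}(\sigma)=\operatorname{dom}(\pi')\cap\operatorname{dom}(\sigma')=\emptyset$, $\operatorname{St}(\pi)=\operatorname{St}(\pi')$ and $\operatorname{St}(\sigma)=\operatorname{St}(\sigma')$,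 the multisets $\{\{\operatorname{St}(\tau):\tau\in S(\pi,\sigma)\}\}$ and $\{\{\operatorname{St}(\tau):\tau\in S(\pi',\sigma')\}\}$ are equal. \textbf{Theorem.} The functions $\operatorname{des}$ and $\pi\mapsto(\operatorname{maj}(\pi),\operatorname{des}(\pi))$ are shuffle compatible permutation statistics. -/

import Mathlib

namespace ShuffleCompat

/-- A permutation: a linear order `π₁ π₂ … πₙ` on a finite set of positive integers,
i.e. a finite sequence of distinct positive integers. -/
abbrev Permutation : Type := {l : List ℕ+ // l.Nodup}

namespace Permutation

/-- The underlying set of a permutation. -/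
def dom (π : Permutation) : Finset ℕ+ := π.val.toFinset

/-- The length `|π|`. -/
def length (π : Permutation) : ℕ := π.val.length

/-- `π` and `π'` have the same relative order: `π'` is obtained from `π` by applying a strictly
increasing map to its entries (which is then the increasing bijection `dom π → dom π'`). -/
def SameRelativeOrder (π π' : Permutation) : Prop :=
  ∃ f : ℕ+ → ℕ+, StrictMonoOn f (π.dom : Set ℕ+) ∧ π'.val = π.val.map f

/-- The descent set `{i | 1 ≤ i < |π|, πᵢ > πᵢ₊₁}`, positions being counted from `1`
(so `πᵢ` is the list entry with index `i - 1`). -/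
def Des (π : Permutation) : Finset ℕ :=
  {i ∈ Finset.Ico 1 π.val.length | ∃ h : i < π.val.length, π.val[i - 1] > π.val[i]}

/-- The descent number. -/
def des (π : Permutation) : ℕ := π.Des.card

/-- The major index. -/
def maj (π : Permutation) : ℕ := ∑ i ∈ π.Des, i

/-- The pair of statistics `(maj, des)`. -/
def majDes (π : Permutation) : ℕ × ℕ := (π.maj, π.des)

/-- The shuffle set of `π` and `σ` (used when `dom π` and `dom σ` are disjoint): the permutations
of `dom π ∪ dom σ` in which both `π` and `σ` occur as (not necessarily contiguous) subwords. -/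
def shuffleSet (π σ : Permutation) : Set Permutation :=
  {τ | τ.dom = π.dom ∪ σ.dom ∧ π.val.Sublist τ.val ∧ σ.val.Sublist τ.val}

theorem finite_shuffleSet (π σ : Permutation) : (shuffleSet π σ).Finite := by
  refine Set.Finite.of_finite_image (f := Subtype.val) ?_ Subtype.val_injective.injOn
  refine ((π.dom ∪ σ.dom).val.toList.permutations.toFinset.finite_toSet).subset ?_
  rintro _ ⟨τ, ⟨hdom, -, -⟩, rfl⟩
  simp only [Finset.mem_coe, List.mem_toFinset, List.mem_permutations]
  rw [← Multiset.coe_eq_coe, Multiset.coe_toList, ← hdom, dom, List.toFinset_val,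
    List.dedup_eq_self.mpr τ.property]

/-- The shuffle set as a finite set. -/
noncomputable def shuffles (π σ : Permutation) : Finset Permutation :=
  (finite_shuffleSet π σ).toFinset

end Permutation

open Permutation in
/-- A permutation statistic: a function on permutations whose value depends only on the relative
order of the entries. -/
def IsPermutationStatistic {α : Type*} (St : Permutation → α) : Prop :=
  ∀ π π' : Permutation, SameRelativeOrder π π' → St π = St π'

/-- The distribution of `St` over a finite set of permutations: the multiset of its values. -/
def distribution {α : Type*} (St : Permutation → α) (P : Finset Permutation) : Multiset α :=
  P.val.map St

open Permutation in
/-- A shuffle compatible permutation statistic. -/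
def IsShuffleCompatible {α : Type*} (St : Permutation → α) : Prop :=
  IsPermutationStatistic St ∧
    ∀ π π' σ σ' : Permutation,
      π.length = π'.length → σ.length = σ'.length →
      Disjoint π.dom σ.dom → Disjoint π'.dom σ'.dom →
      St π = St π' → St σ = St σ' →
      distribution St (shuffles π σ) = distribution St (shuffles π' σ')

end ShuffleCompat

/-! This is Stanley's argument with P-partitions. Attach to a word the sequences `K ≥ f₁ ≥ f₂ ≥ ⋯ ≥
0` that drop strictly at its descents, weighted by `q ^ (f₁ + f₂ + ⋯)`. Given such sequences on two
words with disjoint letters, sorting all pairs (part, letter) by decreasing part, ties by increasing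
letter, yields one shuffle with one such sequence on it. Hence the generating function is
multiplicative over shuffles (`sum_shuffleList_partitionSum`).

Removing the forced drops shows that this function depends only on length, `des` and `q ^ maj`
(`partitionSum_eq`). Letting `K` vary gives a unitriangular system from which the sum of `q ^ maj`
over shuffles with each value of `des` is recovered (`fiberSum_eq_of_sum_map_boundedSum_eq`). Taking
`q = 1` settles `des`; an indeterminate `q` settles `(maj, des)`. -/

namespace ShuffleCompat

/-! ### Shuffles of words -/

/-- The list of all shuffles of two lists, with multiplicity. -/
def shuffleList {α : Type*} : List α → List α → List (List α)
  | [], m => [m]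
  | a :: l, [] => [a :: l]
  | a :: l, b :: m =>
    (shuffleList l (b :: m)).map (List.cons a) ++ (shuffleList (a :: l) m).map (List.cons b)
termination_by l m => l.length + m.length

section ShuffleList

variable {α : Type*}

@[simp] theorem shuffleList_nil_left (m : List α) : shuffleList [] m = [m] := by
  simp [shuffleList]

@[simp] theorem shuffleList_nil_right (l : List α) : shuffleList l [] = [l] := by
  cases l <;> simp [shuffleList]

theorem shuffleList_cons_cons (a b : α) (l m : List α) :
    shuffleList (a :: l) (b :: m) =
      (shuffleList l (b :: m)).map (List.cons a) ++ (shuffleList (a :: l) m).map (List.cons b) := by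
  rw [shuffleList]

/-- Induction on a pair of lists along the recursion of `shuffleList`. -/
theorem shuffleList_induction {P : List α → List α → Prop} (nil_left : ∀ m, P [] m)
    (nil_right : ∀ l, P l [])
    (cons_cons : ∀ a l b m, P l (b :: m) → P (a :: l) m → P (a :: l) (b :: m)) :
    ∀ l m, P l m := by
  intro l
  induction l with
  | nil => exact nil_left
  | cons a l ihl =>
    intro m
    induction m with
    | nil => exact nil_right _
    | cons b m ihm => exact cons_cons a l b m (ihl _) ihm

theorem perm_append_of_mem_shuffleList (l m : List α) :
    ∀ t ∈ shuffleList l m, t.Perm (l ++ m) := by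
  induction l, m using shuffleList_induction with
  | nil_left m => simp
  | nil_right l => simp
  | cons_cons a l b m ih₁ ih₂ =>
    intro t ht
    rw [shuffleList_cons_cons, List.mem_append, List.mem_map, List.mem_map] at ht
    rcases ht with ⟨t, ht, rfl⟩ | ⟨t, ht, rfl⟩
    · exact (ih₁ t ht).cons a
    · exact ((ih₂ t ht).cons b).trans List.perm_middle.symm

theorem sublist_of_mem_shuffleList (l m : List α) :
    ∀ t ∈ shuffleList l m, l.Sublist t ∧ m.Sublist t := by
  induction l, m using shuffleList_induction with
  | nil_left m => simp
  | nil_right l => simp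
  | cons_cons a l b m ih₁ ih₂ =>
    intro t ht
    rw [shuffleList_cons_cons, List.mem_append, List.mem_map, List.mem_map] at ht
    rcases ht with ⟨t, ht, rfl⟩ | ⟨t, ht, rfl⟩
    · exact ⟨(ih₁ t ht).1.cons_cons a, (ih₁ t ht).2.cons a⟩
    · exact ⟨(ih₂ t ht).1.cons b, (ih₂ t ht).2.cons_cons b⟩

theorem mem_shuffleList_of_sublist (l m : List α) (hlm : l.Disjoint m) :
    ∀ t, t.Perm (l ++ m) → l.Sublist t → m.Sublist t → t ∈ shuffleList l m := by
  induction l, m using shuffleList_induction with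
  | nil_left m =>
    intro t ht _ hm
    simp [hm.eq_of_length (by simpa using ht.length_eq.symm)]
  | nil_right l =>
    intro t ht hl _
    simp [hl.eq_of_length (by simpa using ht.length_eq.symm)]
  | cons_cons a l b m ih₁ ih₂ =>
    intro t ht hl hm
    have hab : a ≠ b := fun h => hlm (List.mem_cons_self (a := a)) (by simp [h])
    rw [shuffleList_cons_cons, List.mem_append, List.mem_map, List.mem_map]
    cases t with
    | nil => simp at hl
    | cons c t =>
      by_cases hca : c = a
      · subst hca
        refine Or.inl ⟨t, ih₁ (fun x hx hx' => hlm (List.mem_cons_of_mem _ hx) hx') t ?_ ?_ ?_, rfl⟩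
        · exact (List.perm_cons c).1 ht
        · exact List.cons_sublist_cons.1 hl
        · exact (List.sublist_cons_iff.1 hm).resolve_right (by
            rintro ⟨r, hr, -⟩; exact hab (List.cons.inj hr).1.symm)
      · have hl' : (a :: l).Sublist t := (List.sublist_cons_iff.1 hl).resolve_right (by
          rintro ⟨r, hr, -⟩; exact hca (List.cons.inj hr).1.symm)
        by_cases hcb : c = b
        · subst hcb
          refine Or.inr ⟨t, ih₂ (fun x hx hx' => hlm hx (List.mem_cons_of_mem _ hx')) t ?_ hl' ?_,
            rfl⟩
          · exact (List.perm_cons c).1 (ht.trans List.perm_middle)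
          · exact List.cons_sublist_cons.1 hm
        · have hm' : (b :: m).Sublist t := (List.sublist_cons_iff.1 hm).resolve_right (by
            rintro ⟨r, hr, -⟩; exact hcb (List.cons.inj hr).1.symm)
          -- The letter `c` lies in exactly one of the two words, so it occurs once more in `c :: t`
          -- than in `t`; but that word is already a sublist of `t`.
          classical
          have hc := ht.mem_iff.1 (List.mem_cons_self (a := c))
          have hcount := ht.count_eq c
          rw [List.count_cons_self, List.count_append] at hcount
          rcases List.mem_append.1 hc with h | h
          · have h0 := List.count_eq_zero_of_not_mem (hlm h)
            have := hl'.count_le c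
            omega
          · have h0 := List.count_eq_zero_of_not_mem (fun h' => hlm h' h)
            have := hm'.count_le c
            omega

theorem nodup_shuffleList (l m : List α) (hlm : l.Disjoint m) : (shuffleList l m).Nodup := by
  induction l, m using shuffleList_induction with
  | nil_left m => simp
  | nil_right l => simp
  | cons_cons a l b m ih₁ ih₂ =>
    have hab : a ≠ b := fun h => hlm (List.mem_cons_self (a := a)) (by simp [h])
    rw [shuffleList_cons_cons]
    refine List.Nodup.append ?_ ?_ ?_
    · exact (ih₁ fun x hx hx' => hlm (List.mem_cons_of_mem _ hx) hx').map (List.cons_injective)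
    · exact (ih₂ fun x hx hx' => hlm hx (List.mem_cons_of_mem _ hx')).map (List.cons_injective)
    · intro t h₁ h₂
      obtain ⟨t₁, -, rfl⟩ := List.mem_map.1 h₁
      obtain ⟨t₂, -, h⟩ := List.mem_map.1 h₂
      exact hab (List.cons.inj h).1.symm

end ShuffleList

/-! ### Generating functions of P-partitions -/

/-- The number of `i` with `xᵢ₊₁ ≤ xᵢ` in the sequence `c = x₀, x₁, …` with `l = x₁ x₂ …`. -/
def desFrom : ℕ → List ℕ+ → ℕ
  | _, [] => 0
  | c, a :: l => desFrom a l + if c < a then 0 else 1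

/-- The sum of all `i` with `xᵢ₊₁ ≤ xᵢ` in the sequence `c = x₀, x₁, …` with `l = x₁ x₂ …`. -/
def majFrom : ℕ → List ℕ+ → ℕ
  | _, [] => 0
  | _, a :: l => majFrom a l + desFrom a l

/-- The sum of `q ^ (f₁ + ⋯ + fₙ)` over all `K > f₁ ≥ f₂ ≥ ⋯ ≥ fₙ ≥ 0`. -/
def boundedSum {R : Type*} [CommRing R] (q : R) : ℕ → ℕ → R
  | 0, _ => 1
  | n + 1, K => ∑ j ∈ Finset.range K, q ^ j * boundedSum q n (j + 1)

/-- The sum of `q ^ (f₁ + f₂ + ⋯)` over all `K = f₀ ≥ f₁ ≥ f₂ ≥ ⋯` such that `fᵢ > fᵢ₊₁` whenever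
`xᵢ₊₁ ≤ xᵢ` in the sequence `c = x₀, x₁, …` with `l = x₁ x₂ …`. -/
def partitionSum {R : Type*} [CommRing R] (q : R) : ℕ → ℕ → List ℕ+ → R
  | _, _, [] => 1
  | K, c, a :: l =>
    ∑ j ∈ Finset.range (if c < a then K + 1 else K), q ^ j * partitionSum q j a l

section GeneratingFunctions

variable {R : Type*} [CommRing R] (q : R)

theorem boundedSum_zero_right {n : ℕ} (hn : n ≠ 0) : boundedSum q n 0 = 0 := by
  cases n with
  | zero => exact absurd rfl hn
  | succ n => simp [boundedSum]

theorem boundedSum_one_right (n : ℕ) : boundedSum q n 1 = 1 := by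
  induction n with
  | zero => simp [boundedSum]
  | succ n ih => simp [boundedSum, ih]

/-- Subtract from each part `fᵢ` the number of descents at positions `≥ i`: the drops become weak,
the bound falls by the number of descents, and a descent at `i` costs `q ^ i`. Truncated subtraction
is harmless, since a nonempty sum with bound `0` vanishes. -/
theorem partitionSum_eq (l : List ℕ+) (K c : ℕ) :
    partitionSum q K c l =
      q ^ majFrom c l * boundedSum q l.length (K + 1 - desFrom c l) := by
  induction l generalizing K c with
  | nil => simp [partitionSum, majFrom, boundedSum]
  | cons a l ih =>
    have key : ∀ N : ℕ, ∑ j ∈ Finset.range N, q ^ j * partitionSum q j a l =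
        q ^ (majFrom a l + desFrom a l) *
          boundedSum q (l.length + 1) (N - desFrom a l) := by
      intro N
      simp only [ih, boundedSum, Finset.mul_sum]
      have vanish : ∀ j < desFrom a l, boundedSum q l.length (j + 1 - desFrom a l) = 0 := by
        intro j hj
        rw [show j + 1 - desFrom a l = 0 by omega]
        refine boundedSum_zero_right q fun h => ?_
        rw [List.length_eq_zero_iff.1 h] at hj
        simp [desFrom] at hj
      rcases le_total N (desFrom a l) with hN | hN
      · rw [show N - desFrom a l = 0 by omega, Finset.sum_range_zero]
        refine Finset.sum_eq_zero fun j hj => ?_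
        rw [vanish j (by have := Finset.mem_range.1 hj; omega)]
        simp
      · obtain ⟨M, rfl⟩ := Nat.exists_eq_add_of_le hN
        rw [Finset.sum_range_add, Finset.sum_eq_zero, zero_add]
        · refine Finset.sum_congr (by simp) fun i _ => ?_
          rw [show desFrom a l + i + 1 - desFrom a l = i + 1 by omega]
          ring
        · intro j hj
          rw [vanish j (Finset.mem_range.1 hj)]
          simp
    simp only [partitionSum, majFrom, desFrom, List.length_cons]
    rw [key]
    congr 2
    split_ifs <;> omega

/-- Splitting a double sum according to which of the two pairs `(i, a)`, `(j, b)` comes first. -/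
theorem sum_range_mul_sum_range {a b : ℕ} (hab : a ≠ b) (K c : ℕ) (f g : ℕ → R) :
    (∑ i ∈ Finset.range (if c < a then K + 1 else K), f i) *
        ∑ j ∈ Finset.range (if c < b then K + 1 else K), g j =
      (∑ i ∈ Finset.range (if c < a then K + 1 else K),
        f i * ∑ j ∈ Finset.range (if a < b then i + 1 else i), g j) +
      ∑ j ∈ Finset.range (if c < b then K + 1 else K),
        (∑ i ∈ Finset.range (if b < a then j + 1 else j), f i) * g j := by
  have hcomm : ∑ j ∈ Finset.range (if c < b then K + 1 else K),
        (∑ i ∈ Finset.range (if b < a then j + 1 else j), f i) * g j =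
      ∑ i ∈ Finset.range (if c < a then K + 1 else K),
        ∑ j ∈ (Finset.range (if c < b then K + 1 else K)).filter
          (fun j => ¬ j < if a < b then i + 1 else i), f i * g j := by
    simp only [Finset.sum_mul]
    refine Finset.sum_comm' fun j i => ?_
    simp only [Finset.mem_range, Finset.mem_filter]
    split_ifs <;> omega
  rw [hcomm, Finset.sum_mul, ← Finset.sum_add_distrib]
  refine Finset.sum_congr rfl fun i hi => ?_
  -- By transitivity the bound on `j` from `(K, c)` is implied: either `j < i`, or `j = i` and `a <
  -- b`.
  have hfilter : Finset.range (if a < b then i + 1 else i) =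
      (Finset.range (if c < b then K + 1 else K)).filter
        (fun j => j < if a < b then i + 1 else i) := by
    ext j
    simp only [Finset.mem_range, Finset.mem_filter] at hi ⊢
    split_ifs at hi ⊢ <;> omega
  rw [hfilter, Finset.mul_sum, Finset.mul_sum, Finset.sum_filter_add_sum_filter_not]

theorem sum_map_cons_partitionSum (K c : ℕ) (a : ℕ+) (L : List (List ℕ+)) :
    ((L.map (List.cons a)).map (partitionSum q K c)).sum =
      ∑ j ∈ Finset.range (if c < a then K + 1 else K),
        q ^ j * (L.map (partitionSum q j a)).sum := by
  induction L with
  | nil => simp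
  | cons l L ih =>
    simp only [List.map_cons, List.sum_cons, ih, mul_add, Finset.sum_add_distrib]
    rfl

/-- The two leading pairs (part, letter) are comparable because the letters differ; the one that
comes first supplies the first letter of the shuffle. -/
theorem sum_shuffleList_partitionSum (l m : List ℕ+) (hlm : l.Disjoint m) (K c : ℕ) :
    ((shuffleList l m).map (partitionSum q K c)).sum =
      partitionSum q K c l * partitionSum q K c m := by
  induction l, m using shuffleList_induction generalizing K c with
  | nil_left m => simp [partitionSum]
  | nil_right l => simp [partitionSum]
  | cons_cons a l b m ih₁ ih₂ =>
    have hab : (a : ℕ) ≠ b := fun h =>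
      hlm (List.mem_cons_self (a := a)) (by simp [PNat.coe_injective h])
    rw [shuffleList_cons_cons, List.map_append, List.sum_append, sum_map_cons_partitionSum,
      sum_map_cons_partitionSum]
    simp only [ih₁ fun x hx hx' => hlm (List.mem_cons_of_mem _ hx) hx',
      ih₂ fun x hx hx' => hlm hx (List.mem_cons_of_mem _ hx')]
    simp only [partitionSum]
    rw [sum_range_mul_sum_range hab]
    congr 1
    · exact Finset.sum_congr rfl fun i _ => by ring
    · exact Finset.sum_congr rfl fun i _ => by ring

/-! ### Recovering the distribution -/

/-- The sum of `q ^ p` over the members `(p, d)` of a multiset with given `d`. -/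
def fiberSum (s : Multiset (ℕ × ℕ)) (d : ℕ) : R :=
  (s.map fun x => if x.2 = d then q ^ x.1 else 0).sum

theorem sum_map_boundedSum {n : ℕ} (hn : n ≠ 0) (s : Multiset (ℕ × ℕ)) (K : ℕ) :
    (s.map fun x => q ^ x.1 * boundedSum q n (K + 1 - x.2)).sum =
      ∑ d ∈ Finset.range (K + 1), fiberSum q s d * boundedSum q n (K + 1 - d) := by
  induction s using Multiset.induction_on with
  | empty => simp [fiberSum]
  | cons x s ih =>
    have hsingle : q ^ x.1 * boundedSum q n (K + 1 - x.2) =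
        ∑ d ∈ Finset.range (K + 1),
          (if x.2 = d then q ^ x.1 else 0) * boundedSum q n (K + 1 - d) := by
      simp only [ite_mul, zero_mul, Finset.sum_ite_eq, Finset.mem_range]
      split_ifs with h
      · rfl
      -- Members with second entry above `K` contribute nothing; this is where `n ≠ 0` matters.
      · rw [show K + 1 - x.2 = 0 by omega, boundedSum_zero_right q hn, mul_zero]
    rw [Multiset.map_cons, Multiset.sum_cons, ih, hsingle, ← Finset.sum_add_distrib]
    refine Finset.sum_congr rfl fun d _ => ?_
    rw [fiberSum, fiberSum, Multiset.map_cons, Multiset.sum_cons, add_mul]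

theorem fiberSum_eq_of_sum_map_boundedSum_eq {n : ℕ} (hn : n ≠ 0) {s t : Multiset (ℕ × ℕ)}
    (h : ∀ K : ℕ, (s.map fun x => q ^ x.1 * boundedSum q n (K + 1 - x.2)).sum =
      (t.map fun x => q ^ x.1 * boundedSum q n (K + 1 - x.2)).sum) (d : ℕ) :
    fiberSum q s d = fiberSum q t d := by
  induction d using Nat.strong_induction_on with
  | _ d ih =>
    -- At `K = d` the terms below `d` cancel by induction, and the last has coefficient `boundedSum
    -- q n 1 = 1`, so no division is needed.
    have hd := h d
    rw [sum_map_boundedSum q hn, sum_map_boundedSum q hn, Finset.sum_range_succ,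
      Finset.sum_range_succ, Finset.sum_congr rfl fun e he => by rw [ih e (Finset.mem_range.1 he)],
      add_right_inj, Nat.add_sub_cancel_left, boundedSum_one_right, mul_one, mul_one] at hd
    exact hd

end GeneratingFunctions

theorem fiberSum_one (s : Multiset (ℕ × ℕ)) (d : ℕ) :
    fiberSum (1 : ℤ) s d = ((s.map Prod.snd).count d : ℤ) := by
  induction s using Multiset.induction_on with
  | empty => simp [fiberSum]
  | cons x s ih =>
    rw [fiberSum] at ih
    rw [fiberSum, Multiset.map_cons, Multiset.sum_cons, ih, Multiset.map_cons, Multiset.count_cons]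
    push_cast
    simp only [one_pow, eq_comm (a := d)]
    ring

theorem coeff_fiberSum_X (s : Multiset (ℕ × ℕ)) (p d : ℕ) :
    (fiberSum (Polynomial.X : Polynomial ℤ) s d).coeff p = (s.count (p, d) : ℤ) := by
  induction s using Multiset.induction_on with
  | empty => simp [fiberSum]
  | cons x s ih =>
    rw [fiberSum] at ih
    rw [fiberSum, Multiset.map_cons, Multiset.sum_cons, Polynomial.coeff_add, ih,
      Multiset.count_cons]
    obtain ⟨p', d'⟩ := x
    push_cast
    rw [add_comm]
    congr 1
    by_cases hd : d' = d <;> simp [hd, Polynomial.coeff_X_pow, Prod.ext_iff, eq_comm (a := d)]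

/-- The pairs `(majFrom 0, desFrom 0)` of all shuffles of two lists. -/
def shuffleStats (l m : List ℕ+) : Multiset (ℕ × ℕ) :=
  (shuffleList l m : Multiset (List ℕ+)).map fun t => (majFrom 0 t, desFrom 0 t)

theorem sum_shuffleStats {R : Type*} [CommRing R] (q : R) {l m : List ℕ+} (hlm : l.Disjoint m)
    (K : ℕ) :
    ((shuffleStats l m).map fun x =>
        q ^ x.1 * boundedSum q (l.length + m.length) (K + 1 - x.2)).sum =
      (q ^ majFrom 0 l * boundedSum q l.length (K + 1 - desFrom 0 l)) *
        (q ^ majFrom 0 m * boundedSum q m.length (K + 1 - desFrom 0 m)) := by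
  rw [← partitionSum_eq, ← partitionSum_eq, ← sum_shuffleList_partitionSum q l m hlm,
    shuffleStats, Multiset.map_coe, Multiset.map_coe, Multiset.sum_coe, List.map_map]
  congr 1
  refine List.map_congr_left fun t ht => ?_
  rw [partitionSum_eq, (perm_append_of_mem_shuffleList l m t ht).length_eq, List.length_append]
  rfl

/-- Only the powers `q ^ majFrom` are compared, so that `q = 1` imposes no condition on the major
index. -/
theorem fiberSum_shuffleStats_eq {R : Type*} [CommRing R] (q : R) {l l' m m' : List ℕ+}
    (hl : l.length = l'.length) (hm : m.length = m'.length)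
    (hlm : l.Disjoint m) (hlm' : l'.Disjoint m')
    (hdl : desFrom 0 l = desFrom 0 l') (hdm : desFrom 0 m = desFrom 0 m')
    (hql : q ^ majFrom 0 l = q ^ majFrom 0 l') (hqm : q ^ majFrom 0 m = q ^ majFrom 0 m')
    (d : ℕ) :
    fiberSum q (shuffleStats l m) d = fiberSum q (shuffleStats l' m') d := by
  -- In length `0` the bounded sum is `1` for every bound and separates nothing, so empty words are
  -- treated apart.
  by_cases hn : l.length + m.length = 0
  · have h₁ : l = [] := List.length_eq_zero_iff.1 (by omega)
    have h₂ : m = [] := List.length_eq_zero_iff.1 (by omega)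
    have h₃ : l' = [] := List.length_eq_zero_iff.1 (by omega)
    have h₄ : m' = [] := List.length_eq_zero_iff.1 (by omega)
    rw [h₁, h₂, h₃, h₄]
  · refine fiberSum_eq_of_sum_map_boundedSum_eq q hn (fun K => ?_) d
    rw [sum_shuffleStats q hlm, hl, hm, sum_shuffleStats q hlm', hdl, hdm, hql, hqm]

/-! ### Transfer to permutations -/

namespace Permutation

theorem mem_Des {π : Permutation} {i : ℕ} :
    i ∈ π.Des ↔ ∃ (_ : 1 ≤ i) (h : i < π.val.length), π.val[i - 1] > π.val[i] := by
  simp only [Des, Finset.mem_filter, Finset.mem_Ico]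
  constructor
  · rintro ⟨⟨h₁, -⟩, h₂, h₃⟩
    exact ⟨h₁, h₂, h₃⟩
  · rintro ⟨h₁, h₂, h₃⟩
    exact ⟨⟨h₁, h₂⟩, h₂, h₃⟩

theorem Des_eq_of_sameRelativeOrder {π π' : Permutation} (h : SameRelativeOrder π π') :
    π.Des = π'.Des := by
  obtain ⟨f, hf, hπ⟩ := h
  ext i
  rw [mem_Des, mem_Des]
  simp only [hπ, List.length_map, List.getElem_map, gt_iff_lt]
  refine exists_congr fun _ => exists_congr fun hi => ?_
  exact (hf.lt_iff_lt (by simp [dom]) (by simp [dom])).symm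

theorem Des_cons_cons (a b : ℕ+) (l : List ℕ+) (h : (a :: b :: l).Nodup) :
    Des ⟨a :: b :: l, h⟩ =
      (Des ⟨b :: l, h.of_cons⟩).map (addRightEmbedding 1) ∪ if a < b then ∅ else {1} := by
  have hab : a ≠ b := by
    rintro rfl
    simp at h
  ext i
  rw [Finset.mem_union, Finset.mem_map]
  simp only [mem_Des, addRightEmbedding_apply]
  have hif : (i ∈ if a < b then (∅ : Finset ℕ) else {1}) ↔ b < a ∧ i = 1 := by
    split_ifs with hlt
    · simp [hlt.le]
    · simp [lt_of_le_of_ne (not_lt.1 hlt) hab.symm]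
  rw [hif]
  match i with
  | 0 => simp
  | 1 => simp
  | i + 2 => simp

theorem des_maj_eq (π : Permutation) :
    π.des = desFrom 0 π.val ∧ π.maj = majFrom 0 π.val := by
  obtain ⟨l, hl⟩ := π
  induction l with
  | nil => simp [des, maj, Des, desFrom, majFrom]
  | cons a l ih =>
    cases l with
    | nil => simp [des, maj, Des, desFrom, majFrom]
    | cons b l =>
      obtain ⟨h₁, h₂⟩ := ih hl.of_cons
      have hdisj : Disjoint ((Des ⟨b :: l, hl.of_cons⟩).map (addRightEmbedding 1))
          (if a < b then ∅ else {1}) := by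
        split_ifs
        · simp
        · rw [Finset.disjoint_singleton_right]
          simp [mem_Des]
      have hcard : (if a < b then (∅ : Finset ℕ) else {1}).card = if a < b then 0 else 1 := by
        split_ifs <;> simp
      have hsum : ∑ i ∈ (if a < b then (∅ : Finset ℕ) else {1}), i = if a < b then 0 else 1 := by
        split_ifs <;> simp
      simp only [des, maj] at h₁ h₂ ⊢
      rw [Des_cons_cons, Finset.card_union_of_disjoint hdisj, Finset.sum_union hdisj,
        Finset.card_map, Finset.sum_map, hcard, hsum]
      simp only [addRightEmbedding_apply, Finset.sum_add_distrib, Finset.sum_const, smul_eq_mul,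
        mul_one, h₁, h₂]
      -- The initial value `0` lies below every letter, so position `0` is never a descent.
      simp only [desFrom, majFrom, PNat.pos, if_true, PNat.coe_lt_coe, add_zero]
      exact ⟨trivial, by ring⟩

/-- Disjointness makes `shuffleList` free of repetitions, so comparing members suffices for equality
of multisets. -/
theorem map_val_shuffles {π σ : Permutation} (h : π.val.Disjoint σ.val) :
    (shuffles π σ).val.map Subtype.val = (shuffleList π.val σ.val : Multiset (List ℕ+)) := by
  have hnodup : (π.val ++ σ.val).Nodup := π.property.append σ.property h
  refine (Multiset.Nodup.ext ((shuffles π σ).nodup.map Subtype.val_injective)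
    (Multiset.coe_nodup.2 (nodup_shuffleList _ _ h))).2 fun t => ?_
  rw [Multiset.mem_map, Multiset.mem_coe]
  constructor
  · rintro ⟨τ, hτ, rfl⟩
    rw [Finset.mem_val, shuffles, Set.Finite.mem_toFinset] at hτ
    obtain ⟨hdom, h₁, h₂⟩ := hτ
    refine mem_shuffleList_of_sublist _ _ h _ ?_ h₁ h₂
    refine (List.perm_ext_iff_of_nodup τ.property hnodup).2 fun x => ?_
    have := Finset.ext_iff.1 hdom x
    simpa [dom] using this
  · intro ht
    have hperm := perm_append_of_mem_shuffleList _ _ t ht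
    obtain ⟨h₁, h₂⟩ := sublist_of_mem_shuffleList _ _ t ht
    refine ⟨⟨t, hperm.nodup_iff.2 hnodup⟩, ?_, rfl⟩
    rw [Finset.mem_val, shuffles, Set.Finite.mem_toFinset]
    refine ⟨?_, h₁, h₂⟩
    ext x
    simpa [dom] using hperm.mem_iff (a := x)

theorem distribution_majDes {π σ : Permutation} (h : π.val.Disjoint σ.val) :
    distribution majDes (shuffles π σ) = shuffleStats π.val σ.val := by
  rw [shuffleStats, ← map_val_shuffles h, Multiset.map_map, distribution]
  refine Multiset.map_congr rfl fun τ _ => ?_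
  rw [majDes, (des_maj_eq τ).1, (des_maj_eq τ).2]
  rfl

theorem distribution_des {π σ : Permutation} (h : π.val.Disjoint σ.val) :
    distribution des (shuffles π σ) = (shuffleStats π.val σ.val).map Prod.snd := by
  rw [← distribution_majDes h, distribution, distribution, Multiset.map_map]
  rfl

theorem disjoint_val_of_disjoint_dom {π σ : Permutation} (h : Disjoint π.dom σ.dom) :
    π.val.Disjoint σ.val := fun _ hx hx' =>
  Finset.disjoint_left.1 h (List.mem_toFinset.2 hx) (List.mem_toFinset.2 hx')

theorem isShuffleCompatible_des : IsShuffleCompatible des := by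
  refine ⟨fun π π' h => by rw [des, des, Des_eq_of_sameRelativeOrder h], ?_⟩
  intro π π' σ σ' hπ hσ hd hd' hSπ hSσ
  replace hd := disjoint_val_of_disjoint_dom hd
  replace hd' := disjoint_val_of_disjoint_dom hd'
  rw [(des_maj_eq _).1, (des_maj_eq _).1] at hSπ hSσ
  rw [distribution_des hd, distribution_des hd']
  ext d
  have := fiberSum_shuffleStats_eq (1 : ℤ) hπ hσ hd hd' hSπ hSσ (by simp) (by simp) d
  rw [fiberSum_one, fiberSum_one] at this
  exact_mod_cast this

theorem isShuffleCompatible_majDes : IsShuffleCompatible majDes := by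
  refine ⟨fun π π' h => by rw [majDes, majDes, maj, maj, des, des,
    Des_eq_of_sameRelativeOrder h], ?_⟩
  intro π π' σ σ' hπ hσ hd hd' hSπ hSσ
  replace hd := disjoint_val_of_disjoint_dom hd
  replace hd' := disjoint_val_of_disjoint_dom hd'
  rw [majDes, majDes, Prod.mk.injEq, (des_maj_eq _).1, (des_maj_eq _).1, (des_maj_eq _).2,
    (des_maj_eq _).2] at hSπ hSσ
  rw [distribution_majDes hd, distribution_majDes hd']
  ext ⟨p, d⟩
  have := fiberSum_shuffleStats_eq (Polynomial.X : Polynomial ℤ) hπ hσ hd hd' hSπ.2 hSσ.2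
    (by rw [hSπ.1]) (by rw [hSσ.1]) d
  have := congrArg (fun P => P.coeff p) this
  simp only [coeff_fiberSum_X] at this
  exact_mod_cast this

end Permutation

end ShuffleCompat

/-- The permutation statistics `des` and `(maj, des)` are shuffle compatible. -/
theorem mainTheorem2 :
    ShuffleCompat.IsShuffleCompatible ShuffleCompat.Permutation.des ∧
      ShuffleCompat.IsShuffleCompatible ShuffleCompat.Permutation.majDes :=
  ⟨ShuffleCompat.Permutation.isShuffleCompatible_des,
    ShuffleCompat.Permutation.isShuffleCompatible_majDes⟩
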